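/- Consider a $K$-tier heterogeneous cellular network. For $j\in\mathcal K=\{1,\dots,K\}$ the base stations (BSs) of tier $j$ form a homogeneous Poisson point process (PPP) $\Phi_j$ on $\mathbb R^2$ with density $\lambda_j>0$, the users form a homogeneous PPP $\Phi_u$ with density $\lambda_u>0$, and all these processes are independent; a further, typical user sits at the origin $o$. A BS of tier $j$ has transmit power $P_j>0$, $M_j\ge 1$ antennas and power allocation ratio $\phi_j\in[0,1]$; the path loss exponent is $\alpha>2$. *Association.* Fix an access threshold $\tau>0$. For a user at $x$ let $r_j$ be the distance to the nearest BS of tier $j$, let $D_j=(P_jM_j/\tau)^{1/\alpha}$, and let $\hat P_j=P_jM_jr_j^{-\alpha}$ if $r_j\le D_j$ and $\hat P_j=0$ otherwise. The user is associated with tier $k$ if $\hat P_k>0$ and $\hat P_k>\hat P_j$ for all $j\ne k$; it is then served by the nearest BS of tier $k$. A BS is active if at least one user is associated with it; $\Phi_j^o\subseteq\Phi_j$ denotes the active BSs of tier $j$. *SINR.* For a BS $z$ of tier $j$ let $\mathbf h_{zo}$ and $\mathbf h_z$ be its fading vectors to the typical user and to the other user it serves. All these vectors have i.i.d. $\mathcal{CN}(0,1)$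 entries in $\mathbb C^{M_j}$, and they are mutually independent and independent of all positions. Let $\mathbf w_z=\mathbf h_z^\dagger/\|\mathbf h_z\|$ and let $[\mathbf w_z\ \mathbf W_z]$ be a matrix whose columns form an orthonormal basis of $\mathbb C^{M_j}$. If the typical user is served by the BS $b$ of tier $k$ at distance $R_k$, its SINR in the interference-limited case (no thermal noise) is $$\mathbf{SINR}_{o,k}=\frac{\phi_kP_k\|\mathbf h_{bo}\|^2R_k^{-\alpha}}{\sum_{j\in\mathcal K}I_{jo}},\qquad I_{jo}=\sum_{z\in\Phi_j^o\setminus b}\Big(\phi_jP_j|\mathbf h_{zo}^{\mathrm T}\mathbf w_z|^2+\tfrac{(1-\phi_j)P_j}{M_j-1}\|\mathbf h_{zo}^{\mathrm T}\mathbf W_z\|^2\Big)\|z\|^{-\alpha},$$ where the second term in the bracket is absent if $M_j=1$. For a target $\beta_t>0$ let $\mathcal P^{int}_{c,k}(\tau)$ be the conditional probability that $\mathbf{SINR}_{o,k}\ge\beta_t$, given that the typical user is associated with tier $k$. **Statement.** For every $k\in\mathcal K$ with $\phi_k>0$, $$\lim_{\tau\to\infty}\mathcal P^{int}_{c,k}(\tau)=1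 .$$ The same holds if $\Phi_j^o$ is instead taken to be an independent thinning of $\Phi_j$ that retains each BS of tier $j$, independently of everything else, with probability $\mathcal A_j(\tau)$, for arbitrary $\mathcal A_j(\tau)\in[0,1]$; in particular for $$\mathcal A_j(\tau)=1-\exp\!\big(-\lambda_u(P_jM_j)^{\delta}\,\Xi^{-1}(1-e^{-\pi\tau^{-\delta}\Xi})\big),\qquad \delta=2/\alpha,\quad \Xi=\sum_{i\in\mathcal K}\lambda_i(P_iM_i)^{\delta}.$$ -/

import Mathlib

open MeasureTheory ProbabilityTheory Filter Topology
open scoped ENNReal NNReal Matrix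

noncomputable section

/-- The Euclidean plane. -/
abbrev Plane : Type := EuclideanSpace ℝ (Fin 2)

/-- The number of indices `n` with `X n ω ∈ B`, that is, the number of points (counted with
multiplicity) that the point process `X` puts into `B`. -/
def pointCount {Ω : Type*} (X : ℕ → Ω → Plane) (B : Set Plane) (ω : Ω) : ℕ∞ :=
  {n : ℕ | X n ω ∈ B}.encard

/-- `X 0, X 1, …` is a measurable enumeration of the points of a homogeneous Poisson point process
of density `c > 0` on the plane (which almost surely has infinitely many points): the number of
points in a Borel set of finite area is Poisson distributed with mean `c` times the area, and the
numbers of points in disjoint Borel sets are independent. -/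
structure IsHomogeneousPPP {Ω : Type*} [MeasurableSpace Ω] (μ : Measure Ω)
    (X : ℕ → Ω → Plane) (c : ℝ) : Prop where
  measurable : ∀ n, Measurable (X n)
  count_law : ∀ B : Set Plane, MeasurableSet B → volume B ≠ ∞ → ∀ m : ℕ,
    μ.real {ω | pointCount X B ω = m} =
      Real.exp (-(c * volume.real B)) * (c * volume.real B) ^ m / (m.factorial : ℝ)
  count_indep : ∀ (q : ℕ) (B : Fin q → Set Plane), (∀ i, MeasurableSet (B i)) →
    Pairwise (fun i i' => Disjoint (B i) (B i')) →
    iIndepFun (fun i ω => pointCount X (B i) ω) μ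

/-- The circularly symmetric complex Gaussian law `CN(0,1)`. -/
def complexGaussian : Measure ℂ :=
  ((gaussianReal 0 (1 / 2)).prod (gaussianReal 0 (1 / 2))).map
    Complex.measurableEquivRealProd.symm

/-- The law of a vector of `M` i.i.d. `CN(0,1)` entries. -/
def rayleigh (M : ℕ) : Measure (Fin M → ℂ) := Measure.pi fun _ => complexGaussian

/-- The squared Euclidean norm of a complex vector. -/
def sqNorm {M : ℕ} (v : Fin M → ℂ) : ℝ := ∑ i, ‖v i‖ ^ 2

/-- The maximum ratio beamforming vector `h† / ‖h‖`. -/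
def beam {M : ℕ} (h : Fin M → ℂ) : Fin M → ℂ :=
  fun i => star (h i) / ((Real.sqrt (sqNorm h) : ℝ) : ℂ)

/-- The deterministic parameters of a `K`-tier heterogeneous cellular network. -/
structure HetNet (K : ℕ) where
  /-- density of the base stations of each tier -/
  bsDensity : Fin K → ℝ
  /-- density of the users -/
  ueDensity : ℝ
  /-- transmit power of each tier -/
  power : Fin K → ℝ
  /-- number of antennas of each tier -/
  antennas : Fin K → ℕ
  /-- fraction of the transmit power that is spent on the information signal -/
  ratio : Fin K → ℝ
  /-- path loss exponent -/
  alpha : ℝ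
  bsDensity_pos : ∀ j, 0 < bsDensity j
  ueDensity_pos : 0 < ueDensity
  power_pos : ∀ j, 0 < power j
  antennas_pos : ∀ j, 1 ≤ antennas j
  ratio_nonneg : ∀ j, 0 ≤ ratio j
  ratio_le_one : ∀ j, ratio j ≤ 1
  alpha_gt : 2 < alpha

namespace HetNet

variable {K : ℕ}

/-- The random quantities of the network. The base stations of tier `j` are the `bs j n`, `n ∈ ℕ`,
and the typical user sits at the origin, in addition to the users `ue m`. -/
structure Randomness (N : HetNet K) (Ω : Type*) where
  /-- base station positions -/
  bs : Fin K → ℕ → Ω → Plane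
  /-- user positions -/
  ue : ℕ → Ω → Plane
  /-- small-scale fading from a base station to the typical user -/
  toOrigin : (j : Fin K) → ℕ → Ω → (Fin (N.antennas j) → ℂ)
  /-- small-scale fading from a base station to the other user that it serves (if any) -/
  toServed : (j : Fin K) → ℕ → Ω → (Fin (N.antennas j) → ℂ)
  /-- weight matrix of the artificial noise, when serving that user -/
  weight : (j : Fin K) → ℕ → Ω → Matrix (Fin (N.antennas j)) (Fin (N.antennas j - 1)) ℂ
  /-- uniform variables, used only for independent thinning of the base stations -/
  coin : Fin K → ℕ → Ω → ℝ

/-- The joint law of the random quantities: independent homogeneous Poisson processes of base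
stations and of users; i.i.d. Rayleigh fading and uniform coins, independent of all positions; the
columns of `[w W]`, with `w` the beamforming vector and `W` the weight matrix, are orthonormal. -/
structure IsModel {N : HetNet K} {Ω : Type*} [MeasurableSpace Ω] (μ : Measure Ω)
    (S : N.Randomness Ω) : Prop where
  bs_ppp : ∀ j, IsHomogeneousPPP μ (S.bs j) (N.bsDensity j)
  ue_ppp : IsHomogeneousPPP μ S.ue N.ueDensity
  positions_indep : iIndepFun
    (fun (i : Option (Fin K)) ω (n : ℕ) => (i.elim S.ue S.bs) n ω) μ
  marks_measurable : ∀ j n, Measurable fun ω =>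
    (S.toOrigin j n ω, S.toServed j n ω, S.coin j n ω)
  marks_law : ∀ j n, μ.map (fun ω => (S.toOrigin j n ω, S.toServed j n ω, S.coin j n ω)) =
    (rayleigh (N.antennas j)).prod
      ((rayleigh (N.antennas j)).prod (volume.restrict (Set.Icc (0 : ℝ) 1)))
  marks_indep : iIndepFun (fun (z : (_ : Fin K) × ℕ) ω =>
    (S.toOrigin z.1 z.2 ω, S.toServed z.1 z.2 ω, S.coin z.1 z.2 ω)) μ
  positions_marks_indep : IndepFun
    (fun ω => (fun (j : Fin K) (n : ℕ) => S.bs j n ω, fun n : ℕ => S.ue n ω))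
    (fun ω (z : (_ : Fin K) × ℕ) =>
      (S.toOrigin z.1 z.2 ω, S.toServed z.1 z.2 ω, S.coin z.1 z.2 ω)) μ
  weight_orthonormal : ∀ j n, ∀ᵐ ω ∂μ,
    (S.weight j n ω)ᴴ * S.weight j n ω = 1 ∧
    (S.weight j n ω)ᴴ *ᵥ beam (S.toServed j n ω) = 0

/-- The serving radius `D_j = (P_j M_j / τ)^(1/α)`. -/
def servingRadius (N : HetNet K) (τ : ℝ) (j : Fin K) : ℝ :=
  (N.power j * N.antennas j / τ) ^ (1 / N.alpha)

section
variable {N : HetNet K} {Ω : Type*} (S : N.Randomness Ω)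

/-- The distance from `x` to the nearest base station of tier `j`. -/
def nearest (ω : Ω) (x : Plane) (j : Fin K) : ℝ := ⨅ n, dist (S.bs j n ω) x

open Classical in
/-- The truncated average received signal power of tier `j` for a user at `x`, with access
threshold `τ`. -/
def truncARSP (τ : ℝ) (ω : Ω) (x : Plane) (j : Fin K) : ℝ :=
  if nearest S ω x j ≤ N.servingRadius τ j then
    N.power j * N.antennas j * nearest S ω x j ^ (-N.alpha)
  else 0

/-- A user at `x` is associated with tier `k`: this tier gives the largest truncated average
received signal power, and that power is not zero. -/
def AssocTier (τ : ℝ) (ω : Ω) (x : Plane) (k : Fin K) : Prop :=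
  0 < truncARSP S τ ω x k ∧ ∀ j, j ≠ k → truncARSP S τ ω x j < truncARSP S τ ω x k

/-- A user at `x` is associated with the `n`-th base station of tier `j`. -/
def Serves (τ : ℝ) (ω : Ω) (j : Fin K) (n : ℕ) (x : Plane) : Prop :=
  AssocTier S τ ω x j ∧ dist (S.bs j n ω) x = nearest S ω x j

/-- A base station is active if at least one of the users `ue m` is associated with it. -/
def Active (τ : ℝ) (ω : Ω) (j : Fin K) (n : ℕ) : Prop :=
  ∃ m, Serves S τ ω j n (S.ue m ω)

/-- The independent thinning that retains every base station of tier `j` with probability `p j`. -/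
def Retained (p : Fin K → ℝ) (ω : Ω) (j : Fin K) (n : ℕ) : Prop :=
  S.coin j n ω < p j

/-- The power of information signal and artificial noise that the typical user receives from an
interfering base station of tier `j`. For `φ_j > 0` it is
`φ_j P_j (|hᵀ w|² + ξ_j ‖hᵀ W‖²) r^(-α)` with `ξ_j = (φ_j⁻¹ - 1) / (M_j - 1)`. For `M_j = 1` the
matrix `W` has no columns and the second term vanishes. -/
def interferencePower (ω : Ω) (j : Fin K) (n : ℕ) : ℝ :=
  (N.ratio j * N.power j * ‖S.toOrigin j n ω ⬝ᵥ beam (S.toServed j n ω)‖ ^ 2 +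
    (1 - N.ratio j) * N.power j / (N.antennas j - 1 : ℝ) *
      sqNorm (S.toOrigin j n ω ᵥ* S.weight j n ω)) *
  dist (S.bs j n ω) 0 ^ (-N.alpha)

open Classical in
/-- The interference `∑ⱼ I_{jo}` at the typical user, when it is served by the `b`-th base station
of tier `k`, and `act` tells which base stations are transmitting. -/
def interference (act : Ω → Fin K → ℕ → Prop) (ω : Ω) (k : Fin K) (b : ℕ) : ℝ≥0∞ :=
  ∑ j, ∑' n, if act ω j n ∧ ¬ (j = k ∧ n = b) then
    ENNReal.ofReal (interferencePower S ω j n) else 0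

/-- The SINR of the typical user, served by the `b`-th base station of tier `k`, with noise
power `N₀`. -/
def sinr (act : Ω → Fin K → ℕ → Prop) (N₀ : ℝ≥0) (ω : Ω) (k : Fin K) (b : ℕ) : ℝ≥0∞ :=
  ENNReal.ofReal (N.ratio k * N.power k * sqNorm (S.toOrigin k b ω) *
      dist (S.bs k b ω) 0 ^ (-N.alpha)) /
    (interference S act ω k b + N₀)

/-- The connection probability of the typical user given that it is associated with tier `k`: the
conditional probability that the SINR from its serving base station is at least `β`. -/
def connectionProb [MeasurableSpace Ω] (μ : Measure Ω) (τ : ℝ)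
    (act : Ω → Fin K → ℕ → Prop) (N₀ : ℝ≥0) (β : ℝ) (k : Fin K) : ℝ :=
  (μ[|{ω | AssocTier S τ ω 0 k}]).real
    {ω | ∃ b, Serves S τ ω k b 0 ∧ ENNReal.ofReal β ≤ sinr S act N₀ ω k b}

/-- The interference-limited connection probability: no thermal noise. -/
def connectionProbInt [MeasurableSpace Ω] (μ : Measure Ω) (τ : ℝ)
    (act : Ω → Fin K → ℕ → Prop) (β : ℝ) (k : Fin K) : ℝ :=
  connectionProb S μ τ act 0 β k

end

end HetNet

end

/-! All serving radii `D_j` shrink like `τ^(-1/α)`, so some disk of radius `ρ`, proportional to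
`τ^(-1/α)`, contains every serving disk. Association with tier `k` has probability at least of order
`V = πρ²` (`le_measureReal_assocTier`). It therefore suffices that failure of the SINR bound,
jointly with association, has probability `o(V)`.

Given association, the serving station lies within `ρ`, and three events can spoil the bound. A
second station in the disk (`crowded`) costs `O(V²)`. A fading gain below `η` costs `εV` for `η`
small, since the Rayleigh law has no atom at `0`. Otherwise the signal is at least `φ_k P_k η
ρ^(-α)`, and all interferers lie outside the disk. Relative to `ρ^(-α)`, the total power from
outside has mean of order `ρ²`, because `α > 2`, and it is independent of the occupation of the
disk. Markov's inequality on that event makes `strongInterference` cost `O(V) · o(1)`.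

The interference is bounded by that of all stations outside the disk, transmitting or not. Hence the
activity rule is irrelevant, and both claims are instances of `tendsto_connectionProbInt`, where
`act` is arbitrary. -/

/-! ### Poisson counts, intensity measure and Campbell's formula -/

lemma toENNReal_pointCount {Ω : Type*} (X : ℕ → Ω → Plane) (B : Set Plane) (ω : Ω) :
    (pointCount X B ω : ℝ≥0∞) = ∑' n, B.indicator 1 (X n ω) := by
  rw [pointCount, ← ENNReal.tsum_set_one, tsum_subtype {n | X n ω ∈ B} fun _ => (1 : ℝ≥0∞)]
  rfl

lemma pointCount_ne_zero_iff {Ω : Type*} {X : ℕ → Ω → Plane} {B : Set Plane} {ω : Ω} :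
    pointCount X B ω ≠ 0 ↔ ∃ n, X n ω ∈ B := by
  rw [pointCount, Set.encard_ne_zero]; rfl

lemma measurable_pointCount {Ω : Type*} [MeasurableSpace Ω] {X : ℕ → Ω → Plane}
    {B : Set Plane} (hX : ∀ n, Measurable (X n)) (hB : MeasurableSet B) :
    Measurable (pointCount X B) := by
  have h : Measurable fun ω => (pointCount X B ω : ℝ≥0∞) := by
    simp only [toENNReal_pointCount]
    exact Measurable.tsum fun n =>
      (measurable_one.indicator hB).comp (hX n)
  refine measurable_to_countable' fun m => ?_
  convert h (measurableSet_singleton (m : ℝ≥0∞)) using 1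
  ext ω
  simp

lemma hasSum_poisson_mean (a : ℝ) :
    HasSum (fun m : ℕ => (m : ℝ) * (Real.exp (-a) * a ^ m / (m.factorial : ℝ))) a := by
  -- The term `m = 0` vanishes, and `m aᵐ / m! = a · aᵐ⁻¹ / (m-1)!` turns the rest into the
  -- exponential series.
  rw [← hasSum_nat_add_iff' 1]
  have h := (NormedSpace.expSeries_div_hasSum_exp a).mul_left (a * Real.exp (-a))
  rw [← Real.exp_eq_exp_ℝ, mul_assoc, ← Real.exp_add, neg_add_cancel, Real.exp_zero, mul_one] at h
  simp only [Finset.range_one, Finset.sum_singleton, Nat.cast_zero, zero_mul, sub_zero]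
  refine h.congr_fun fun m => ?_
  rw [Nat.factorial_succ]
  push_cast
  field_simp
  ring

namespace IsHomogeneousPPP

variable {Ω : Type*} [MeasurableSpace Ω] {μ : Measure Ω} {X : ℕ → Ω → Plane} {c : ℝ}
  {B C : Set Plane}

lemma measurable_pointCount (hX : IsHomogeneousPPP μ X c) (hB : MeasurableSet B) :
    Measurable (pointCount X B) :=
  _root_.measurable_pointCount hX.measurable hB

/-- The Poisson weights sum to one, which leaves no mass for the value `∞`. -/
lemma ae_pointCount_lt_top [IsProbabilityMeasure μ] (hX : IsHomogeneousPPP μ X c)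
    (hB : MeasurableSet B) (hB' : volume B ≠ ∞) : ∀ᵐ ω ∂μ, ∃ m : ℕ, pointCount X B ω = m := by
  set a : ℝ := c * volume.real B
  have hm : ∀ m : ℕ, MeasurableSet {ω | pointCount X B ω = m} := fun m =>
    hX.measurable_pointCount hB (measurableSet_singleton (m : ℕ∞))
  have hd : Pairwise (Function.onFun Disjoint fun m : ℕ => {ω | pointCount X B ω = m}) := by
    intro m n hmn
    refine Set.disjoint_left.2 fun ω h1 h2 => hmn ?_
    have h1 : pointCount X B ω = m := h1
    have h2 : pointCount X B ω = n := h2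
    exact_mod_cast h1.symm.trans h2
  have hs : HasSum (fun m : ℕ => Real.exp (-a) * a ^ m / (m.factorial : ℝ)) 1 := by
    have := (NormedSpace.expSeries_div_hasSum_exp a).mul_left (Real.exp (-a))
    rw [← Real.exp_eq_exp_ℝ, ← Real.exp_add, neg_add_cancel, Real.exp_zero] at this
    simpa only [mul_div_assoc] using this
  have h1 : μ.real (⋃ m : ℕ, {ω | pointCount X B ω = m}) = 1 := by
    rw [Measure.real, measure_iUnion hd hm, ENNReal.tsum_toReal_eq fun m => measure_ne_top _ _,
      ← hs.tsum_eq]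
    exact tsum_congr fun m => hX.count_law B hB hB' m
  have h2 := (prob_compl_eq_zero_iff (μ := μ) (MeasurableSet.iUnion hm)).2
    (by rw [← ENNReal.toReal_eq_one_iff]; exact h1)
  rw [ae_iff]
  convert h2 using 2
  ext ω; simp

lemma lintegral_pointCount_of_ne_top [IsProbabilityMeasure μ] (hX : IsHomogeneousPPP μ X c)
    (hc : 0 ≤ c) (hB : MeasurableSet B) (hB' : volume B ≠ ∞) :
    ∫⁻ ω, (pointCount X B ω : ℝ≥0∞) ∂μ = ENNReal.ofReal c * volume B := by
  set a : ℝ := c * volume.real B with ha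
  have ha0 : 0 ≤ a := by positivity
  have hm : ∀ m : ℕ, MeasurableSet {ω | pointCount X B ω = m} := fun m =>
    hX.measurable_pointCount hB (measurableSet_singleton (m : ℕ∞))
  have hd : Pairwise (Function.onFun Disjoint fun m : ℕ => {ω | pointCount X B ω = m}) := by
    intro m n hmn
    refine Set.disjoint_left.2 fun ω h1 h2 => hmn ?_
    have h1 : pointCount X B ω = m := h1
    have h2 : pointCount X B ω = n := h2
    exact_mod_cast h1.symm.trans h2
  have hu : μ.restrict (⋃ m : ℕ, {ω | pointCount X B ω = m}) = μ :=
    Measure.restrict_eq_self_of_ae_mem <| by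
      filter_upwards [hX.ae_pointCount_lt_top hB hB'] with ω h
      simpa using h
  have hs := hasSum_poisson_mean a
  conv_lhs => rw [← hu]
  rw [lintegral_iUnion hm hd]
  have h1 : ∀ m : ℕ, ∫⁻ ω in {ω | pointCount X B ω = m}, (pointCount X B ω : ℝ≥0∞) ∂μ =
      ENNReal.ofReal ((m : ℝ) * (Real.exp (-a) * a ^ m / (m.factorial : ℝ))) := by
    intro m
    rw [setLIntegral_congr_fun (g := fun _ => (m : ℝ≥0∞)) (hm m)
      (fun ω (h : pointCount X B ω = m) => by simp [h]), setLIntegral_const,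
      ENNReal.ofReal_mul (by positivity), ENNReal.ofReal_natCast, ← hX.count_law B hB hB' m,
      ofReal_measureReal]
  rw [tsum_congr h1, ← ENNReal.ofReal_tsum_of_nonneg (fun m => by positivity) hs.summable,
    hs.tsum_eq, ha, ENNReal.ofReal_mul hc, ofReal_measureReal hB']

/-- Turns expected counts into a measure in `B`, so that Campbell's formula becomes an identity of
measures. The measure `ν` is free in order to allow `μ` restricted to an event. -/
lemma lintegral_pointCount_eq_sum_map (hX : IsHomogeneousPPP μ X c) (ν : Measure Ω)
    (hB : MeasurableSet B) :
    ∫⁻ ω, (pointCount X B ω : ℝ≥0∞) ∂ν = Measure.sum (fun n => ν.map (X n)) B := by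
  simp only [toENNReal_pointCount]
  have hm : ∀ n, Measurable fun ω => B.indicator (1 : Plane → ℝ≥0∞) (X n ω) := fun n =>
    (measurable_one.indicator hB).comp (hX.measurable n)
  rw [lintegral_tsum fun n => (hm n).aemeasurable, Measure.sum_apply _ hB]
  refine tsum_congr fun n => ?_
  rw [Measure.map_apply (hX.measurable n) hB, ← lintegral_indicator_one (hX.measurable n hB)]
  rfl

/-- The intensity measure of a homogeneous Poisson point process. -/
lemma sum_map_eq [IsProbabilityMeasure μ] (hX : IsHomogeneousPPP μ X c) (hc : 0 ≤ c) :
    Measure.sum (fun n => μ.map (X n)) = ENNReal.ofReal c • volume := by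
  -- The count law covers only sets of finite area, so the measures are compared on an exhaustion by
  -- such sets.
  refine Measure.ext_of_iUnion_eq_univ (iUnion_spanningSets (volume : Measure Plane)) fun i => ?_
  ext B hB
  have hm := hB.inter (measurableSet_spanningSets (volume : Measure Plane) i)
  rw [Measure.restrict_apply hB, Measure.restrict_apply hB,
    ← hX.lintegral_pointCount_eq_sum_map μ hm, hX.lintegral_pointCount_of_ne_top hc hm]
  · simp
  · exact ((measure_mono Set.inter_subset_right).trans_lt (measure_spanningSets_lt_top _ i)).ne

lemma lintegral_pointCount [IsProbabilityMeasure μ] (hX : IsHomogeneousPPP μ X c)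
    (hc : 0 ≤ c) (hB : MeasurableSet B) :
    ∫⁻ ω, (pointCount X B ω : ℝ≥0∞) ∂μ = ENNReal.ofReal c * volume B := by
  rw [hX.lintegral_pointCount_eq_sum_map μ hB, hX.sum_map_eq hc]; simp

/-- Campbell's formula on an event that is independent of the restriction of the process. -/
lemma lintegral_tsum_on_indep [IsProbabilityMeasure μ] (hX : IsHomogeneousPPP μ X c)
    (hc : 0 ≤ c) (hB : MeasurableSet B) {E : Set Ω} (hE : MeasurableSet E)
    (hind : ∀ C ⊆ B, MeasurableSet C → IndepFun (E.indicator (1 : Ω → ℝ≥0∞)) (pointCount X C) μ)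
    {g : Plane → ℝ≥0∞} (hg : Measurable g) :
    ∫⁻ ω in E, ∑' n, B.indicator g (X n ω) ∂μ =
      μ E * (ENNReal.ofReal c * ∫⁻ x in B, g x) := by
  -- Restricting to `E` multiplies the intensity on `B` by `μ E`, because `E` is independent of each
  -- count inside `B`.
  have h : (Measure.sum fun n => (μ.restrict E).map (X n)).restrict B =
      (μ E * ENNReal.ofReal c) • volume.restrict B := by
    ext C hC
    have hCB := hC.inter hB
    rw [Measure.restrict_apply hC, ← hX.lintegral_pointCount_eq_sum_map _ hCB,
      ← lintegral_indicator hE]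
    have h1 := lintegral_mul_eq_lintegral_mul_lintegral_of_indepFun
      (measurable_one.indicator hE) (Measurable.of_discrete.comp (hX.measurable_pointCount hCB))
      ((hind _ Set.inter_subset_right hCB).comp (measurable_id)
        (Measurable.of_discrete (f := fun m : ℕ∞ => (m : ℝ≥0∞))))
    rw [lintegral_indicator_one hE] at h1
    simp only [Measure.smul_apply, Measure.restrict_apply hC, smul_eq_mul]
    rw [mul_assoc, ← hX.lintegral_pointCount hc hCB]
    refine Eq.trans (lintegral_congr fun ω => ?_) h1
    by_cases hω : ω ∈ E <;> simp [hω]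
  have hg' := hg.indicator hB
  have hm : ∀ n, Measurable fun ω => B.indicator g (X n ω) := fun n => hg'.comp (hX.measurable n)
  rw [lintegral_tsum fun n => (hm n).aemeasurable]
  have h2 : ∀ n, ∫⁻ ω in E, B.indicator g (X n ω) ∂μ =
      ∫⁻ x, B.indicator g x ∂((μ.restrict E).map (X n)) := fun n =>
    (lintegral_map hg' (hX.measurable n)).symm
  rw [tsum_congr h2, ← lintegral_sum_measure, lintegral_indicator hB, h, lintegral_smul_measure,
    smul_eq_mul, mul_assoc]

section Counts

variable (hX : IsHomogeneousPPP μ X c)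
include hX

lemma measureReal_pointCount_eq_zero (hB : MeasurableSet B) (hB' : volume B ≠ ∞) :
    μ.real {ω | pointCount X B ω = 0} = Real.exp (-(c * volume.real B)) := by
  simpa using hX.count_law B hB hB' 0

variable [IsProbabilityMeasure μ]

lemma measureReal_pointCount_ne_zero (hB : MeasurableSet B) (hB' : volume B ≠ ∞) :
    μ.real {ω | pointCount X B ω ≠ 0} = 1 - Real.exp (-(c * volume.real B)) := by
  rw [← hX.measureReal_pointCount_eq_zero hB hB']
  exact probReal_compl_eq_one_sub (hX.measurable_pointCount hB (measurableSet_singleton 0))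

lemma measureReal_pointCount_ne_zero_le (hB : MeasurableSet B) (hB' : volume B ≠ ∞) :
    μ.real {ω | pointCount X B ω ≠ 0} ≤ c * volume.real B := by
  rw [hX.measureReal_pointCount_ne_zero hB hB']
  linarith [Real.add_one_le_exp (-(c * volume.real B))]

lemma le_measureReal_pointCount_ne_zero (hc : 0 ≤ c) (hB : MeasurableSet B)
    (hB' : volume B ≠ ∞) :
    c * volume.real B - (c * volume.real B) ^ 2 ≤ μ.real {ω | pointCount X B ω ≠ 0} := by
  rw [hX.measureReal_pointCount_ne_zero hB hB']
  set a := c * volume.real B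
  have ha : 0 ≤ a := by positivity
  -- This gives `1 - e⁻ᵃ ≥ a / (1 + a) ≥ a - a²`.
  have h1 : (1 + a) * Real.exp (-a) ≤ 1 := by
    have h := mul_le_mul_of_nonneg_right (Real.add_one_le_exp a) (Real.exp_pos (-a)).le
    rw [← Real.exp_add, add_neg_cancel, Real.exp_zero] at h
    linarith
  nlinarith [Real.exp_pos (-a), mul_nonneg ha ha, mul_nonneg ha (mul_nonneg ha ha)]

lemma measureReal_one_lt_pointCount_le (hc : 0 ≤ c) (hB : MeasurableSet B)
    (hB' : volume B ≠ ∞) :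
    μ.real {ω | 1 < pointCount X B ω} ≤ (c * volume.real B) ^ 2 := by
  set a := c * volume.real B
  have ha : 0 ≤ a := by positivity
  have hm := hX.measurable_pointCount hB
  have h0 := hX.measureReal_pointCount_eq_zero hB hB'
  have h1 : μ.real {ω | pointCount X B ω = 1} = Real.exp (-a) * a := by
    simpa using hX.count_law B hB hB' 1
  have hd : Disjoint {ω | pointCount X B ω = 0} {ω | pointCount X B ω = 1} := by
    refine Set.disjoint_left.2 fun ω h1 h2 => ?_
    have h1 : pointCount X B ω = 0 := h1
    have h2 : pointCount X B ω = 1 := h2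
    simp [h1] at h2
  have hu := measureReal_union (μ := μ) hd (hm (measurableSet_singleton 1))
  have hc := probReal_compl_eq_one_sub (μ := μ)
    ((hm (measurableSet_singleton 0)).union (hm (measurableSet_singleton 1)))
  have he : {ω | 1 < pointCount X B ω} =
      (pointCount X B ⁻¹' {0} ∪ pointCount X B ⁻¹' {1})ᶜ := by
    ext ω
    simp only [Set.mem_ofPred_eq, Set.mem_compl_iff, Set.mem_union, Set.mem_preimage,
      Set.mem_singleton_iff, ← not_le, Order.le_one_iff]
  rw [he, hc]
  change 1 - μ.real ({ω | pointCount X B ω = 0} ∪ {ω | pointCount X B ω = 1}) ≤ _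
  rw [hu, h0, h1]
  -- Uses `1 - (1 + a) e⁻ᵃ ≤ 1 - (1 + a)(1 - a) = a²`.
  nlinarith [Real.add_one_le_exp (-a), Real.exp_pos (-a)]

end Counts

end IsHomogeneousPPP

/-! ### Norm bounds for beamforming, Rayleigh fading and path loss -/

lemma sqNorm_nonneg {M : ℕ} (v : Fin M → ℂ) : 0 ≤ sqNorm v :=
  Finset.sum_nonneg fun _ _ => by positivity

lemma measurable_sqNorm {M : ℕ} : Measurable (sqNorm : (Fin M → ℂ) → ℝ) := by
  unfold sqNorm; fun_prop

lemma coe_sqNorm {M : ℕ} (v : Fin M → ℂ) : (sqNorm v : ℂ) = v ⬝ᵥ star v := by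
  simp [sqNorm, dotProduct, Complex.mul_conj, Complex.normSq_eq_norm_sq]

lemma norm_dotProduct_sq_le {M : ℕ} (v w : Fin M → ℂ) :
    ‖v ⬝ᵥ w‖ ^ 2 ≤ sqNorm v * sqNorm w := by
  refine le_trans ?_ (Finset.sum_mul_sq_le_sq_mul_sq Finset.univ (fun i => ‖v i‖) fun i => ‖w i‖)
  gcongr
  exact (norm_sum_le _ _).trans_eq (Finset.sum_congr rfl fun i _ => norm_mul _ _)

/-- Only an inequality, since for `h = 0` the quotient `0 / 0` is `0`. -/
lemma sqNorm_beam_le_one {M : ℕ} (h : Fin M → ℂ) : sqNorm (beam h) ≤ 1 := by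
  have h0 := sqNorm_nonneg h
  have : sqNorm (beam h) = sqNorm h / sqNorm h := by
    conv_lhs => unfold sqNorm beam
    simp only [norm_div, norm_star, Complex.norm_real, Real.norm_eq_abs, div_pow, sq_abs,
      Real.sq_sqrt h0, ← Finset.sum_div]
    rfl
  rw [this]
  exact div_self_le_one _

lemma sqNorm_mulVec_of_orthonormal {m n : ℕ} {W : Matrix (Fin m) (Fin n) ℂ} (hW : Wᴴ * W = 1)
    (u : Fin n → ℂ) : sqNorm (W *ᵥ u) = sqNorm u := by
  have : (sqNorm (W *ᵥ u) : ℂ) = sqNorm u := by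
    rw [coe_sqNorm, coe_sqNorm, Matrix.star_mulVec, dotProduct_comm, ← Matrix.dotProduct_mulVec,
      Matrix.mulVec_mulVec, hW, Matrix.one_mulVec, dotProduct_comm]
  exact_mod_cast this

/-- With `y = hᵀW`, one has `‖y‖² = h ⬝ᵥ (W ȳ)` and `‖W ȳ‖ = ‖y‖`. Cauchy–Schwarz then gives `‖y‖⁴ ≤
‖h‖² ‖y‖²`. -/
lemma sqNorm_vecMul_le {m n : ℕ} {W : Matrix (Fin m) (Fin n) ℂ} (hW : Wᴴ * W = 1)
    (h : Fin m → ℂ) : sqNorm (h ᵥ* W) ≤ sqNorm h := by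
  set y := h ᵥ* W with hy
  have h1 : (sqNorm y : ℂ) = h ⬝ᵥ (W *ᵥ star y) := by
    rw [coe_sqNorm, Matrix.dotProduct_mulVec]
  have h2 : sqNorm (star y) = sqNorm y := by simp [sqNorm]
  have h3 := norm_dotProduct_sq_le h (W *ᵥ star y)
  rw [← h1, sqNorm_mulVec_of_orthonormal hW, h2, Complex.norm_real, Real.norm_eq_abs, sq_abs] at h3
  rcases (sqNorm_nonneg y).eq_or_lt with h0 | h0
  · rw [← h0]; exact sqNorm_nonneg h
  · nlinarith

instance : IsProbabilityMeasure complexGaussian :=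
  Measure.isProbabilityMeasure_map Complex.measurableEquivRealProd.symm.measurable.aemeasurable

instance (M : ℕ) : IsProbabilityMeasure (rayleigh M) := by
  unfold rayleigh; infer_instance

lemma lintegral_normSq_complexGaussian_ne_top :
    ∫⁻ z, ENNReal.ofReal (‖z‖ ^ 2) ∂complexGaussian ≠ ∞ := by
  have hi : Integrable (fun x : ℝ => x ^ 2) (gaussianReal 0 (1 / 2)) :=
    (memLp_id_gaussianReal (μ := 0) (v := 1 / 2) 2).integrable_sq
  have h2 := (hi.comp_fst (gaussianReal 0 (1 / 2))).add (hi.comp_snd (gaussianReal 0 (1 / 2)))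
  rw [complexGaussian, lintegral_map (by fun_prop)
    Complex.measurableEquivRealProd.symm.measurable]
  refine (lt_of_eq_of_lt (lintegral_congr fun p => ?_) h2.lintegral_lt_top).ne
  congr 1
  rw [← Complex.normSq_eq_norm_sq, Complex.normSq_apply]
  simp [Complex.measurableEquivRealProd, pow_two]

lemma complexGaussian_singleton_zero : complexGaussian {0} = 0 := by
  rw [complexGaussian, MeasurableEquiv.map_apply]
  refine measure_mono_null (t := {0} ×ˢ Set.univ) ?_ ?_
  · rintro ⟨x, y⟩ h
    have : (Complex.measurableEquivRealProd.symm (x, y)).re = 0 := by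
      rw [Set.mem_preimage, Set.mem_singleton_iff] at h; rw [h]; rfl
    exact ⟨this, trivial⟩
  · have := nullSingletonClass_gaussianReal (μ := 0) (v := 1 / 2) (by norm_num)
    rw [Measure.prod_prod, measure_singleton, zero_mul]

lemma lintegral_sqNorm_rayleigh_ne_top (M : ℕ) :
    ∫⁻ v, ENNReal.ofReal (sqNorm v) ∂rayleigh M ≠ ∞ := by
  have h : ∀ v : Fin M → ℂ, ENNReal.ofReal (sqNorm v) = ∑ i, ENNReal.ofReal (‖v i‖ ^ 2) :=
    fun v => ENNReal.ofReal_sum_of_nonneg fun _ _ => by positivity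
  simp only [h]
  rw [lintegral_finsetSum _ fun i _ => by fun_prop]
  refine ENNReal.sum_ne_top.2 fun i _ => ?_
  have := (measurePreserving_eval (fun _ : Fin M => complexGaussian) i).lintegral_comp
    (f := fun z => ENNReal.ofReal (‖z‖ ^ 2)) (by fun_prop)
  exact (this.trans_ne lintegral_normSq_complexGaussian_ne_top)

/-- Continuity from above: the sets shrink to `{0}`, which is null because there is at least one
coordinate. -/
lemma exists_rayleigh_sqNorm_lt_le {M : ℕ} (hM : 1 ≤ M) {ε : ℝ≥0∞} (hε : 0 < ε) :
    ∃ η : ℝ, 0 < η ∧ rayleigh M {v | sqNorm v < η} ≤ ε := by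
  have hm : ∀ r, MeasurableSet {v : Fin M → ℂ | sqNorm v < r} := fun r =>
    measurable_sqNorm measurableSet_Iio
  have h := tendsto_measure_biInter_gt (μ := rayleigh M)
    (s := fun r : ℝ => {v : Fin M → ℂ | sqNorm v < r}) (a := 0)
    (fun r _ => (hm r).nullMeasurableSet)
    (fun i j _ hij v (hv : _ < i) => lt_of_lt_of_le hv hij) ⟨1, one_pos, measure_ne_top _ _⟩
  have h0 : rayleigh M (⋂ r, ⋂ (_ : r > (0 : ℝ)), {v : Fin M → ℂ | sqNorm v < r}) = 0 := by
    let i : Fin M := ⟨0, hM⟩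
    refine measure_mono_null (t := Function.eval i ⁻¹' {0}) (fun v hv => ?_) ?_
    · have h1 : sqNorm v ≤ 0 := le_of_forall_pos_lt_add fun r hr => by
        simpa using Set.mem_iInter₂.1 hv r hr
      have h2 : ‖v i‖ ^ 2 ≤ sqNorm v :=
        Finset.single_le_sum (f := fun i => ‖v i‖ ^ 2) (fun _ _ => by positivity)
          (Finset.mem_univ i)
      have h3 : ‖v i‖ ^ 2 = 0 := le_antisymm (h2.trans h1) (by positivity)
      simpa using h3
    · rw [rayleigh, (measurePreserving_eval (fun _ : Fin M => complexGaussian) i).measure_preimage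
        (measurableSet_singleton _).nullMeasurableSet]
      exact complexGaussian_singleton_zero
  rw [h0] at h
  obtain ⟨η, h1, h2⟩ := ((h.eventually (Iic_mem_nhds hε)).and self_mem_nhdsWithin).exists
  exact ⟨η, h2, h1⟩

/-- The path loss outside the disk of radius `ρ`, relative to the path loss at distance `ρ`. -/
noncomputable def relPathLoss (α ρ : ℝ) (x : Plane) : ℝ≥0∞ := ENNReal.ofReal ((‖x‖ / ρ) ^ (-α))

@[fun_prop]
lemma measurable_relPathLoss (α ρ : ℝ) : Measurable (relPathLoss α ρ) := by
  unfold relPathLoss; fun_prop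

/-- Dominated convergence with majorant `2^α (1 + ‖x‖)^(-α)`, integrable on the plane because `α >
2`. For `ρ < 1` and `‖x‖ ≥ ρ`, both `1` and `‖x‖` are at most `‖x‖ / ρ`. -/
lemma tendsto_lintegral_relPathLoss {α : ℝ} (hα : 2 < α) :
    Tendsto (fun ρ => ∫⁻ x in (Metric.ball (0 : Plane) ρ)ᶜ, relPathLoss α ρ x) (𝓝[>] 0)
      (𝓝 0) := by
  have hmeas : ∀ ρ : ℝ, MeasurableSet (Metric.ball (0 : Plane) ρ)ᶜ := fun ρ =>
    measurableSet_ball.compl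
  simp_rw [← lintegral_indicator (hmeas _)]
  have hb : ∫⁻ x : Plane, ENNReal.ofReal (2 ^ α) * ENNReal.ofReal ((1 + ‖x‖) ^ (-α)) ≠ ∞ := by
    rw [lintegral_const_mul' _ _ ENNReal.ofReal_ne_top]
    exact ENNReal.mul_ne_top ENNReal.ofReal_ne_top
      (finite_integral_one_add_norm (by simpa using hα)).ne
  rw [show (0 : ℝ≥0∞) = ∫⁻ _ : Plane, 0 by simp]
  refine tendsto_lintegral_filter_of_dominated_convergence _
    (Eventually.of_forall fun ρ => (measurable_relPathLoss α ρ).indicator (hmeas ρ)) ?_ hb ?_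
  · filter_upwards [Ioo_mem_nhdsGT (one_pos : (0 : ℝ) < 1)] with ρ hρ
    refine Eventually.of_forall fun x => Set.indicator_apply_le' (fun hx => ?_) fun _ => zero_le
    have hx : ρ ≤ ‖x‖ := by simpa using hx
    have h1 : 1 ≤ ‖x‖ / ρ := (one_le_div hρ.1).2 hx
    have h2 : ‖x‖ ≤ ‖x‖ / ρ := le_div_self (norm_nonneg _) hρ.1 hρ.2.le
    rw [relPathLoss, ← ENNReal.ofReal_mul (by positivity)]
    refine ENNReal.ofReal_le_ofReal ?_
    calc (‖x‖ / ρ) ^ (-α) ≤ (2⁻¹ * (1 + ‖x‖)) ^ (-α) :=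
          Real.rpow_le_rpow_of_nonpos (by positivity) (by linarith) (by linarith)
      _ = 2 ^ α * (1 + ‖x‖) ^ (-α) := by
          rw [Real.mul_rpow (by norm_num) (by positivity), Real.inv_rpow (by norm_num),
            Real.rpow_neg (by norm_num), inv_inv]
  · have h0 : ∀ᵐ x : Plane, x ≠ 0 := Measure.ae_ne volume 0
    filter_upwards [h0] with x hx
    have h1 : Tendsto (fun ρ : ℝ => ‖x‖ / ρ) (𝓝[>] 0) atTop :=
      tendsto_inv_nhdsGT_zero.const_mul_atTop (norm_pos_iff.2 hx)
    have h2 : Tendsto (fun ρ : ℝ => relPathLoss α ρ x) (𝓝[>] 0) (𝓝 0) := by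
      simpa [relPathLoss] using
        ENNReal.tendsto_ofReal ((tendsto_rpow_neg_atTop (by linarith : 0 < α)).comp h1)
    exact tendsto_of_tendsto_of_tendsto_of_le_of_le tendsto_const_nhds h2 (fun _ => zero_le)
      fun ρ => Set.indicator_le_self _ _ _

/-! ### Deterministic analysis: the SINR bound outside the bad events -/

namespace HetNet

variable {K : ℕ} {N : HetNet K} {Ω : Type*}

/-- An upper bound for the factor by which a base station of tier `j` multiplies the fading
gain `‖h‖²` and the path loss in its contribution to the interference. -/
noncomputable def interfererGain (N : HetNet K) (j : Fin K) : ℝ :=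
  N.ratio j * N.power j + (1 - N.ratio j) * N.power j / (N.antennas j - 1 : ℝ)

lemma antennas_sub_one_nonneg (N : HetNet K) (j : Fin K) : (0 : ℝ) ≤ N.antennas j - 1 := by
  have : (1 : ℝ) ≤ N.antennas j := by exact_mod_cast N.antennas_pos j
  linarith

lemma noiseGain_nonneg (N : HetNet K) (j : Fin K) :
    0 ≤ (1 - N.ratio j) * N.power j / (N.antennas j - 1 : ℝ) :=
  div_nonneg (mul_nonneg (sub_nonneg.2 (N.ratio_le_one j)) (N.power_pos j).le)
    (N.antennas_sub_one_nonneg j)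

lemma interfererGain_nonneg (N : HetNet K) (j : Fin K) : 0 ≤ N.interfererGain j :=
  add_nonneg (mul_nonneg (N.ratio_nonneg j) (N.power_pos j).le) (N.noiseGain_nonneg j)

section Deterministic

variable (S : N.Randomness Ω)

/-- The interference from all base stations outside the disk of radius `ρ`, whether active or not,
relative to the path loss at distance `ρ`. -/
noncomputable def farInterference (ρ : ℝ) (ω : Ω) : ℝ≥0∞ :=
  ∑ j, ∑' n, (Metric.ball (0 : Plane) ρ)ᶜ.indicator (relPathLoss N.alpha ρ) (S.bs j n ω) *
    ENNReal.ofReal (N.interfererGain j * sqNorm (S.toOrigin j n ω))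

/-- The event that tier `k` has a base station in `B`. -/
def occupied (k : Fin K) (B : Set Plane) : Set Ω := {ω | pointCount (S.bs k) B ω ≠ 0}

/-- The event that, besides some base station of tier `k`, the disk of radius `ρ` contains another
base station. -/
def crowded (k : Fin K) (ρ : ℝ) : Set Ω :=
  {ω | 1 < pointCount (S.bs k) (Metric.ball 0 ρ) ω} ∪
    ⋃ j ∈ ({k}ᶜ : Set (Fin K)),
      occupied S k (Metric.ball 0 ρ) ∩ occupied S j (Metric.ball 0 ρ)

/-- The event that some base station of tier `k` in the disk of radius `ρ` has small fading gain
to the typical user. -/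
def weakFading (k : Fin K) (ρ η : ℝ) : Set Ω :=
  {ω | ∃ n, S.bs k n ω ∈ Metric.ball (0 : Plane) ρ ∧ sqNorm (S.toOrigin k n ω) < η}

/-- The event that tier `k` has a base station in the disk of radius `ρ`, and the interference
from outside is large. -/
def strongInterference (k : Fin K) (ρ x : ℝ) : Set Ω :=
  occupied S k (Metric.ball 0 ρ) ∩ {ω | ENNReal.ofReal x ≤ farInterference S ρ ω}

variable {S}

lemma notMem_ball_of_notMem_crowded {k : Fin K} {ρ : ℝ} {ω : Ω} (hω : ω ∉ crowded S k ρ) {b : ℕ}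
    (hb : S.bs k b ω ∈ Metric.ball (0 : Plane) ρ) {j : Fin K} {n : ℕ} (hjn : ¬ (j = k ∧ n = b)) :
    S.bs j n ω ∉ Metric.ball (0 : Plane) ρ := by
  intro hn
  simp only [crowded, Set.mem_union, not_or, Set.mem_iUnion, not_exists] at hω
  by_cases hj : j = k
  · subst hj
    have h1 : pointCount (S.bs j) (Metric.ball 0 ρ) ω ≤ 1 := not_lt.1 hω.1
    exact hjn ⟨rfl, Set.encard_le_one_iff.1 h1 n b hn hb⟩
  · exact hω.2 j hj ⟨pointCount_ne_zero_iff.2 ⟨b, hb⟩, pointCount_ne_zero_iff.2 ⟨n, hn⟩⟩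

lemma nearest_le (ω : Ω) (x : Plane) (j : Fin K) (n : ℕ) :
    nearest S ω x j ≤ dist (S.bs j n ω) x :=
  ciInf_le ⟨0, by rintro _ ⟨n, rfl⟩; exact dist_nonneg⟩ n

/-- Ensures that the infimum in `nearest` is attained, as `Serves` requires. -/
lemma nearest_eq_of_notMem_crowded {k : Fin K} {ρ : ℝ} {ω : Ω} (hω : ω ∉ crowded S k ρ) {b : ℕ}
    (hb : S.bs k b ω ∈ Metric.ball (0 : Plane) ρ) :
    dist (S.bs k b ω) 0 = nearest S ω 0 k := by
  refine le_antisymm (le_ciInf fun n => ?_) (nearest_le ω 0 k b)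
  by_cases hn : n = b
  · rw [hn]
  · have := notMem_ball_of_notMem_crowded hω hb (j := k) (n := n) (by simp [hn])
    exact (Metric.mem_ball.1 hb).le.trans (not_lt.1 this)

lemma servingRadius_pos (N : HetNet K) {τ : ℝ} (hτ : 0 < τ) (j : Fin K) :
    0 < N.servingRadius τ j := by
  have := N.power_pos j
  have : (0 : ℝ) < N.antennas j := by exact_mod_cast N.antennas_pos j
  unfold servingRadius; positivity

/-- The other tiers have no station within `ρ`, hence none within their serving radii, and their
truncated power is zero. The origin is removed because `0 ^ (-α) = 0` for real powers, so a station
there would count as having zero power. -/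
lemma assocTier_of_notMem_crowded {k : Fin K} {ρ τ : ℝ} {ω : Ω}
    (hρ : ∀ j, N.servingRadius τ j < ρ) (hω : ω ∉ crowded S k ρ)
    (ho : ω ∈ occupied S k (Metric.ball 0 (N.servingRadius τ k) \ {0})) :
    AssocTier S τ ω 0 k := by
  obtain ⟨b, hb, hb0⟩ := pointCount_ne_zero_iff.1 ho
  have hb' : S.bs k b ω ∈ Metric.ball (0 : Plane) ρ := Metric.ball_subset_ball (hρ k).le hb
  have hpos : 0 < dist (S.bs k b ω) 0 := dist_pos.2 hb0
  have h1 : 0 < truncARSP S τ ω 0 k := by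
    have := N.power_pos k
    have : (0 : ℝ) < N.antennas k := by exact_mod_cast N.antennas_pos k
    rw [truncARSP, ← nearest_eq_of_notMem_crowded hω hb', if_pos (Metric.mem_ball.1 hb).le]
    positivity
  refine ⟨h1, fun j hj => ?_⟩
  have h2 : ρ ≤ nearest S ω 0 j := le_ciInf fun n =>
    not_lt.1 (notMem_ball_of_notMem_crowded hω hb' (j := j) (n := n) (by simp [hj]))
  rw [truncARSP, if_neg (not_le.2 ((hρ j).trans_le h2))]
  exact h1

lemma interferencePower_le {ω : Ω} {j : Fin K} {n : ℕ}
    (hW : (S.weight j n ω)ᴴ * S.weight j n ω = 1) :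
    interferencePower S ω j n ≤
      N.interfererGain j * sqNorm (S.toOrigin j n ω) * dist (S.bs j n ω) 0 ^ (-N.alpha) := by
  have h1 : ‖S.toOrigin j n ω ⬝ᵥ beam (S.toServed j n ω)‖ ^ 2 ≤ sqNorm (S.toOrigin j n ω) :=
    (norm_dotProduct_sq_le _ _).trans
      (mul_le_of_le_one_right (sqNorm_nonneg _) (sqNorm_beam_le_one _))
  have h2 := sqNorm_vecMul_le hW (S.toOrigin j n ω)
  rw [interferencePower, interfererGain]
  refine mul_le_mul_of_nonneg_right ?_ (by positivity)
  rw [add_mul]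
  refine add_le_add ?_ ?_
  · exact mul_le_mul_of_nonneg_left h1 (mul_nonneg (N.ratio_nonneg j) (N.power_pos j).le)
  · exact mul_le_mul_of_nonneg_left h2 (N.noiseGain_nonneg j)

/-- Dropping the condition `act` is harmless here, which makes every later estimate uniform in the
activity rule. -/
lemma interference_le {k : Fin K} {ρ : ℝ} {ω : Ω} (hρ : 0 < ρ)
    (hW : ∀ j n, (S.weight j n ω)ᴴ * S.weight j n ω = 1) (hω : ω ∉ crowded S k ρ) {b : ℕ}
    (hb : S.bs k b ω ∈ Metric.ball (0 : Plane) ρ) (act : Ω → Fin K → ℕ → Prop) :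
    interference S act ω k b ≤ ENNReal.ofReal (ρ ^ (-N.alpha)) * farInterference S ρ ω := by
  rw [interference, farInterference, Finset.mul_sum]
  refine Finset.sum_le_sum fun j _ => ?_
  rw [← ENNReal.tsum_mul_left]
  refine ENNReal.tsum_le_tsum fun n => ?_
  split_ifs with h
  · have hn := notMem_ball_of_notMem_crowded hω hb h.2
    have hg := mul_nonneg (N.interfererGain_nonneg j) (sqNorm_nonneg (S.toOrigin j n ω))
    rw [Set.indicator_of_mem hn, relPathLoss, ← mul_assoc, ← ENNReal.ofReal_mul (by positivity),
      ← ENNReal.ofReal_mul (by positivity), ← Real.mul_rpow hρ.le (by positivity),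
      mul_div_cancel₀ _ hρ.ne', ← dist_zero_right, mul_comm]
    exact ENNReal.ofReal_le_ofReal (interferencePower_le (hW j n))
  · exact zero_le

lemma exists_serves_le_sinr {k : Fin K} {ρ τ β η : ℝ} {ω : Ω} (hk : 0 < N.ratio k) (hβ : 0 < β)
    (hη : 0 < η) (hρ : N.servingRadius τ k < ρ)
    (hW : ∀ j n, (S.weight j n ω)ᴴ * S.weight j n ω = 1) (hA : AssocTier S τ ω 0 k)
    (hω : ω ∉ crowded S k ρ) (hfad : ω ∉ weakFading S k ρ η)
    (hint : ω ∉ strongInterference S k ρ (N.ratio k * N.power k * η / β))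
    (act : Ω → Fin K → ℕ → Prop) :
    ∃ b, Serves S τ ω k b 0 ∧ ENNReal.ofReal β ≤ sinr S act 0 ω k b := by
  have hα : 0 < N.alpha := by linarith [N.alpha_gt]
  have hP := N.power_pos k
  have hn : nearest S ω 0 k ≤ N.servingRadius τ k := by
    by_contra h
    have := hA.1
    rw [truncARSP, if_neg h] at this
    exact this.false
  obtain ⟨b, hb⟩ := exists_lt_of_ciInf_lt (hn.trans_lt hρ)
  have hb : S.bs k b ω ∈ Metric.ball (0 : Plane) ρ := hb
  have hd := nearest_eq_of_notMem_crowded hω hb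
  refine ⟨b, ⟨hA, hd⟩, ?_⟩
  -- At distance `0` the convention `0 ^ (-α) = 0` would contradict the positive power in `hA`.
  have hd0 : 0 < dist (S.bs k b ω) 0 := by
    refine lt_of_le_of_ne dist_nonneg fun h => ?_
    have := hA.1
    rw [truncARSP, if_pos hn, ← hd, ← h, Real.zero_rpow (by linarith), mul_zero] at this
    exact this.false
  have hρ0 : 0 < ρ := hd0.trans hb
  have hh : η ≤ sqNorm (S.toOrigin k b ω) := not_lt.1 fun h => hfad ⟨b, hb, h⟩
  have hfar : farInterference S ρ ω ≤ ENNReal.ofReal (N.ratio k * N.power k * η / β) :=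
    (not_le.1 fun h => hint ⟨pointCount_ne_zero_iff.2 ⟨b, hb⟩, h⟩).le
  have hsig : N.ratio k * N.power k * η * ρ ^ (-N.alpha) ≤ N.ratio k * N.power k *
      sqNorm (S.toOrigin k b ω) * dist (S.bs k b ω) 0 ^ (-N.alpha) := by
    have hr : ρ ^ (-N.alpha) ≤ dist (S.bs k b ω) 0 ^ (-N.alpha) :=
      Real.rpow_le_rpow_of_nonpos hd0 (Metric.mem_ball.1 hb).le (by linarith)
    have := sqNorm_nonneg (S.toOrigin k b ω)
    gcongr
  have hs0 : 0 < N.ratio k * N.power k * η * ρ ^ (-N.alpha) := by positivity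
  -- The interference may be `0` or `∞`, so the division is cleared using that the signal is
  -- positive and finite.
  rw [sinr, ENNReal.coe_zero, add_zero, ENNReal.le_div_iff_mul_le
    (Or.inr (ENNReal.ofReal_pos.2 (hs0.trans_le hsig)).ne') (Or.inr ENNReal.ofReal_ne_top)]
  calc ENNReal.ofReal β * interference S act ω k b
      ≤ ENNReal.ofReal β * (ENNReal.ofReal (ρ ^ (-N.alpha)) *
          ENNReal.ofReal (N.ratio k * N.power k * η / β)) := by
        gcongr
        exact (interference_le hρ0 hW hω hb act).trans (by gcongr)
    _ = ENNReal.ofReal (N.ratio k * N.power k * η * ρ ^ (-N.alpha)) := by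
        rw [← ENNReal.ofReal_mul (by positivity), ← ENNReal.ofReal_mul hβ.le]
        congr 1
        field_simp
    _ ≤ _ := ENNReal.ofReal_le_ofReal hsig

end Deterministic

end HetNet

/-! ### Probabilities of the bad events -/

namespace HetNet

variable {K : ℕ} {N : HetNet K} {Ω : Type*} [MeasurableSpace Ω] {μ : Measure Ω}
  {S : N.Randomness Ω} {B C : Set Plane}

lemma volume_real_ball {r : ℝ} (hr : 0 ≤ r) :
    volume.real (Metric.ball (0 : Plane) r) = Real.pi * r ^ 2 := by
  rw [Measure.real, EuclideanSpace.volume_ball_fin_two, ENNReal.toReal_mul, ENNReal.toReal_pow,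
    ENNReal.toReal_ofReal hr, ENNReal.toReal_ofReal Real.pi_pos.le, mul_comm]

namespace IsModel

variable (hS : IsModel μ S)
include hS

lemma measurableSet_occupied (j : Fin K) (hB : MeasurableSet B) :
    MeasurableSet (occupied S j B) :=
  (hS.bs_ppp j).measurable_pointCount hB (measurableSet_singleton 0).compl

lemma indepFun_bs {j k : Fin K} (hjk : j ≠ k) :
    IndepFun (fun ω n => S.bs j n ω) (fun ω n => S.bs k n ω) μ :=
  hS.positions_indep.indepFun (i := some j) (j := some k) (by simpa using hjk)

lemma indepFun_pointCount_of_ne {j k : Fin K} (hjk : j ≠ k) (hB : MeasurableSet B)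
    (hC : MeasurableSet C) :
    IndepFun (pointCount (S.bs j) B) (pointCount (S.bs k) C) μ :=
  (hS.indepFun_bs hjk).comp
    (measurable_pointCount (X := fun n (p : ℕ → Plane) => p n) measurable_pi_apply hB)
    (measurable_pointCount (X := fun n (p : ℕ → Plane) => p n) measurable_pi_apply hC)

lemma indepFun_pointCount_of_disjoint (j k : Fin K) (hB : MeasurableSet B)
    (hC : MeasurableSet C) (hBC : Disjoint B C) :
    IndepFun (pointCount (S.bs j) B) (pointCount (S.bs k) C) μ := by
  by_cases hjk : j = k
  · subst hjk
    have h := (hS.bs_ppp j).count_indep 2 ![B, C] (by simp [Fin.forall_fin_two, hB, hC])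
      (by
        intro i i' hii'
        fin_cases i <;> fin_cases i' <;> simp_all [disjoint_comm])
    exact h.indepFun (i := 0) (j := 1) (by simp)
  · exact hS.indepFun_pointCount_of_ne hjk hB hC

lemma measurable_toOrigin (j : Fin K) (n : ℕ) : Measurable (S.toOrigin j n) :=
  (hS.marks_measurable j n).fst

lemma map_toOrigin (j : Fin K) (n : ℕ) :
    μ.map (S.toOrigin j n) = rayleigh (N.antennas j) := by
  have : IsProbabilityMeasure (volume.restrict (Set.Icc (0 : ℝ) 1)) := ⟨by simp⟩
  have h := congrArg (Measure.map Prod.fst) (hS.marks_law j n)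
  rwa [Measure.map_map measurable_fst (hS.marks_measurable j n), Measure.map_fst_prod,
    measure_univ, one_smul] at h

lemma indepFun_bs_toOrigin (j : Fin K) (n : ℕ) :
    IndepFun (fun ω (i : Fin K) (m : ℕ) => S.bs i m ω) (S.toOrigin j n) μ :=
  hS.positions_marks_indep.comp measurable_fst
    (measurable_fst.comp (measurable_pi_apply (⟨j, n⟩ : (_ : Fin K) × ℕ)))

lemma measurableSet_assocTier (τ : ℝ) (k : Fin K) : MeasurableSet {ω | AssocTier S τ ω 0 k} := by
  have hn : ∀ j, Measurable fun ω => nearest S ω 0 j := fun j =>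
    Measurable.iInf fun n => ((hS.bs_ppp j).measurable n).dist measurable_const
  have ht : ∀ j, Measurable fun ω => truncARSP S τ ω 0 j := fun j =>
    Measurable.ite (measurableSet_le (hn j) measurable_const)
      (((hn j).pow_const _).const_mul _) measurable_const
  have h : {ω | AssocTier S τ ω 0 k} = {ω | 0 < truncARSP S τ ω 0 k} ∩
      ⋂ j ∈ ({k}ᶜ : Set (Fin K)), {ω | truncARSP S τ ω 0 j < truncARSP S τ ω 0 k} := by
    ext ω; simp [AssocTier]
  rw [h]
  exact (measurableSet_lt measurable_const (ht k)).inter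
    (MeasurableSet.biInter (Set.to_countable _) fun j _ => measurableSet_lt (ht j) (ht k))

lemma measurable_farInterference (ρ : ℝ) : Measurable (farInterference S ρ) := by
  refine Finset.measurable_sum _ fun j _ => Measurable.tsum fun n => Measurable.mul ?_ ?_
  · exact ((measurable_relPathLoss _ _).indicator measurableSet_ball.compl).comp
      ((hS.bs_ppp j).measurable n)
  · exact ((measurable_sqNorm.comp (hS.measurable_toOrigin j n)).const_mul _).ennreal_ofReal

variable [IsProbabilityMeasure μ]

/-- Each way of having two stations in the disk costs two factors `πρ²`: by the Poisson law within
tier `k`, by independence across tiers. -/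
lemma measureReal_crowded_le (k : Fin K) {ρ : ℝ} (hρ : 0 ≤ ρ) :
    μ.real (crowded S k ρ) ≤
      N.bsDensity k * (N.bsDensity k + ∑ j, N.bsDensity j) * (Real.pi * ρ ^ 2) ^ 2 := by
  have hv : volume (Metric.ball (0 : Plane) ρ) ≠ ∞ := measure_ball_lt_top.ne
  have hB : MeasurableSet (Metric.ball (0 : Plane) ρ) := measurableSet_ball
  have h1 := (hS.bs_ppp k).measureReal_one_lt_pointCount_le (N.bsDensity_pos k).le hB hv
  have ho : ∀ j, μ.real (occupied S j (Metric.ball 0 ρ)) ≤ N.bsDensity j * (Real.pi * ρ ^ 2) :=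
    fun j => by
      rw [← volume_real_ball hρ]
      exact (hS.bs_ppp j).measureReal_pointCount_ne_zero_le hB hv
  have h2 : ∀ j ∈ ({k}ᶜ : Set (Fin K)),
      μ.real (occupied S k (Metric.ball 0 ρ) ∩ occupied S j (Metric.ball 0 ρ)) ≤
        N.bsDensity k * (Real.pi * ρ ^ 2) * (N.bsDensity j * (Real.pi * ρ ^ 2)) := fun j hj => by
    have h := (hS.indepFun_pointCount_of_ne (Ne.symm hj) hB hB).measure_inter_preimage_eq_mul
      {0}ᶜ {0}ᶜ (measurableSet_singleton 0).compl (measurableSet_singleton 0).compl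
    have h' : μ.real (occupied S k (Metric.ball 0 ρ) ∩ occupied S j (Metric.ball 0 ρ)) =
        μ.real (occupied S k (Metric.ball 0 ρ)) * μ.real (occupied S j (Metric.ball 0 ρ)) := by
      rw [Measure.real, Measure.real, Measure.real, ← ENNReal.toReal_mul]
      exact congrArg _ h
    rw [h']
    exact mul_le_mul (ho k) (ho j) measureReal_nonneg (measureReal_nonneg.trans (ho k))
  have h3 : μ.real (⋃ j ∈ ({k}ᶜ : Set (Fin K)),
      occupied S k (Metric.ball 0 ρ) ∩ occupied S j (Metric.ball 0 ρ)) ≤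
        ∑ j, N.bsDensity k * (Real.pi * ρ ^ 2) * (N.bsDensity j * (Real.pi * ρ ^ 2)) := by
    refine (measureReal_iUnion_fintype_le _).trans (Finset.sum_le_sum fun j _ => ?_)
    by_cases hj : j ∈ ({k}ᶜ : Set (Fin K))
    · simpa [hj] using h2 j hj
    · have := N.bsDensity_pos k
      have := N.bsDensity_pos j
      simp only [hj, Set.iUnion_of_empty, measureReal_empty]
      positivity
  rw [volume_real_ball hρ] at h1
  refine (measureReal_union_le _ _).trans ((add_le_add h1 h3).trans_eq ?_)
  rw [← Finset.mul_sum, ← Finset.sum_mul]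
  ring

/-- Union bound over the stations: position and fading are independent, and the position
probabilities add up to the intensity measure of the disk. -/
lemma measure_weakFading_le (k : Fin K) (ρ η : ℝ) :
    μ (weakFading S k ρ η) ≤ ENNReal.ofReal (N.bsDensity k) * volume (Metric.ball (0 : Plane) ρ) *
      rayleigh (N.antennas k) {v | sqNorm v < η} := by
  have hη : MeasurableSet {v : Fin (N.antennas k) → ℂ | sqNorm v < η} :=
    measurable_sqNorm measurableSet_Iio
  have hB : MeasurableSet (Metric.ball (0 : Plane) ρ) := measurableSet_ball
  have h1 : weakFading S k ρ η = ⋃ n, S.bs k n ⁻¹' Metric.ball 0 ρ ∩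
      S.toOrigin k n ⁻¹' {v | sqNorm v < η} := by
    ext ω; simp [weakFading]
  have h2 : ∀ n, μ (S.bs k n ⁻¹' Metric.ball 0 ρ ∩ S.toOrigin k n ⁻¹' {v | sqNorm v < η}) =
      μ.map (S.bs k n) (Metric.ball 0 ρ) * rayleigh (N.antennas k) {v | sqNorm v < η} := fun n => by
    have hφ : Measurable fun p : Fin K → ℕ → Plane => p k n := by fun_prop
    have hi : IndepFun (S.bs k n) (S.toOrigin k n) μ :=
      (hS.indepFun_bs_toOrigin k n).comp hφ measurable_id
    rw [hi.measure_inter_preimage_eq_mul _ _ hB hη,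
      Measure.map_apply ((hS.bs_ppp k).measurable n) hB, ← hS.map_toOrigin k n,
      Measure.map_apply (hS.measurable_toOrigin k n) hη]
  rw [h1]
  refine (measure_iUnion_le _).trans_eq ?_
  rw [tsum_congr h2, ENNReal.tsum_mul_right, ← Measure.sum_apply _ hB,
    (hS.bs_ppp k).sum_map_eq (N.bsDensity_pos k).le]
  rfl

/-- The factor `μ (occupied …)` comes out because the event concerns the inside of the disk and the
integrand only stations outside, with fading independent of all positions. -/
lemma lintegral_farInterference_occupied (k : Fin K) (ρ : ℝ) :
    ∫⁻ ω in occupied S k (Metric.ball 0 ρ), farInterference S ρ ω ∂μ =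
      μ (occupied S k (Metric.ball 0 ρ)) *
        ((∑ j, ENNReal.ofReal (N.bsDensity j) * (ENNReal.ofReal (N.interfererGain j) *
          ∫⁻ v, ENNReal.ofReal (sqNorm v) ∂rayleigh (N.antennas j))) *
        ∫⁻ x in (Metric.ball (0 : Plane) ρ)ᶜ, relPathLoss N.alpha ρ x) := by
  set B := Metric.ball (0 : Plane) ρ
  have hB : MeasurableSet B := measurableSet_ball
  set E := occupied S k B with hE
  have hEm : MeasurableSet E := hS.measurableSet_occupied k hB
  set g : Plane → ℝ≥0∞ := Bᶜ.indicator (relPathLoss N.alpha ρ)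
  have hg : Measurable g := (measurable_relPathLoss _ _).indicator hB.compl
  have hgX : ∀ j n, Measurable fun ω => g (S.bs j n ω) := fun j n =>
    hg.comp ((hS.bs_ppp j).measurable n)
  have hhm : ∀ j n, Measurable fun ω =>
      ENNReal.ofReal (N.interfererGain j * sqNorm (S.toOrigin j n ω)) := fun j n =>
    ((measurable_sqNorm.comp (hS.measurable_toOrigin j n)).const_mul _).ennreal_ofReal
  -- Both `E` and the station's location are functions of the positions, so the fading gain averages
  -- out separately.
  have hmark : ∀ j n, ∫⁻ ω in E, g (S.bs j n ω) *
      ENNReal.ofReal (N.interfererGain j * sqNorm (S.toOrigin j n ω)) ∂μ =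
      (∫⁻ ω in E, g (S.bs j n ω) ∂μ) * (ENNReal.ofReal (N.interfererGain j) *
        ∫⁻ v, ENNReal.ofReal (sqNorm v) ∂rayleigh (N.antennas j)) := fun j n => by
    have hφ : Measurable ({p : Fin K → ℕ → Plane | pointCount (fun n p => p k n) B p ≠ 0}.indicator
        fun p => g (p j n)) := by
      refine (hg.comp ((measurable_pi_apply n).comp (measurable_pi_apply j))).indicator ?_
      exact measurable_pointCount
        (fun n => (measurable_pi_apply n).comp (measurable_pi_apply k)) hB
        (measurableSet_singleton 0).compl
    have hψ : Measurable fun v : Fin (N.antennas j) → ℂ =>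
        ENNReal.ofReal (N.interfererGain j * sqNorm v) :=
      (measurable_sqNorm.const_mul _).ennreal_ofReal
    have h := lintegral_mul_eq_lintegral_mul_lintegral_of_indepFun''
      (hφ.comp (measurable_pi_lambda _ fun i => measurable_pi_lambda _ fun m =>
        (hS.bs_ppp i).measurable m)).aemeasurable
      (hψ.comp (hS.measurable_toOrigin j n)).aemeasurable
      ((hS.indepFun_bs_toOrigin j n).comp hφ hψ)
    have hm : ∫⁻ ω, ENNReal.ofReal (N.interfererGain j * sqNorm (S.toOrigin j n ω)) ∂μ =
        ENNReal.ofReal (N.interfererGain j) *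
          ∫⁻ v, ENNReal.ofReal (sqNorm v) ∂rayleigh (N.antennas j) := by
      rw [← lintegral_const_mul _ measurable_sqNorm.ennreal_ofReal, ← hS.map_toOrigin j n,
        lintegral_map (measurable_sqNorm.ennreal_ofReal.const_mul _) (hS.measurable_toOrigin j n)]
      exact lintegral_congr fun ω => ENNReal.ofReal_mul (N.interfererGain_nonneg j)
    rw [← hm, ← lintegral_indicator hEm, ← lintegral_indicator hEm]
    refine Eq.trans (lintegral_congr fun ω => ?_) h
    exact Set.indicator_mul_left E (fun ω => g (S.bs j n ω)) _
  -- Valid for `j = k` too, by independence of counts in disjoint sets.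
  have hcamp : ∀ j, ∑' n, ∫⁻ ω in E, g (S.bs j n ω) ∂μ =
      μ E * (ENNReal.ofReal (N.bsDensity j) * ∫⁻ x in Bᶜ, relPathLoss N.alpha ρ x) := fun j => by
    rw [← lintegral_tsum fun n => (hgX j n).aemeasurable]
    refine (hS.bs_ppp j).lintegral_tsum_on_indep (N.bsDensity_pos j).le hB.compl hEm
      (fun C hC hCm => ?_) (measurable_relPathLoss _ _)
    exact (hS.indepFun_pointCount_of_disjoint k j hB hCm
      (Set.disjoint_left.2 fun x hx hxC => hC hxC hx)).comp
      (φ := ({0}ᶜ : Set ℕ∞).indicator (1 : ℕ∞ → ℝ≥0∞)) Measurable.of_discrete measurable_id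
  have hprod : ∀ j n, Measurable fun ω => g (S.bs j n ω) *
      ENNReal.ofReal (N.interfererGain j * sqNorm (S.toOrigin j n ω)) := fun j n =>
    (hgX j n).mul (hhm j n)
  change ∫⁻ ω in E, ∑ j, ∑' n, g (S.bs j n ω) *
      ENNReal.ofReal (N.interfererGain j * sqNorm (S.toOrigin j n ω)) ∂μ = _
  rw [lintegral_finsetSum _ fun j _ => Measurable.tsum fun n => hprod j n,
    Finset.sum_mul, Finset.mul_sum]
  refine Finset.sum_congr rfl fun j _ => ?_
  rw [lintegral_tsum fun n => (hprod j n).aemeasurable, tsum_congr (hmark j),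
    ENNReal.tsum_mul_right, hcamp]
  ring

end IsModel

end HetNet

/-! ### Asymptotics as the disk shrinks -/

namespace HetNet

variable {K : ℕ} {N : HetNet K} {Ω : Type*} [MeasurableSpace Ω] {μ : Measure Ω}
  {S : N.Randomness Ω}

lemma servingRadius_eq (N : HetNet K) {τ : ℝ} (hτ : 0 ≤ τ) (j : Fin K) :
    N.servingRadius τ j =
      (N.power j * N.antennas j) ^ (1 / N.alpha) * τ ^ (-(1 / N.alpha)) := by
  have := N.power_pos j
  rw [servingRadius, Real.div_rpow (by positivity) hτ, Real.rpow_neg hτ, div_eq_mul_inv]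

lemma exists_radius (N : HetNet K) (k : Fin K) :
    ∃ (κ : ℝ) (ρ : ℝ → ℝ), 0 < κ ∧ Tendsto ρ atTop (𝓝[>] 0) ∧
      ∀ᶠ τ in atTop, (∀ j, N.servingRadius τ j < ρ τ) ∧ N.servingRadius τ k = κ * ρ τ := by
  set d : Fin K → ℝ := fun j => (N.power j * N.antennas j) ^ (1 / N.alpha) with hd
  have hd0 : ∀ j, 0 < d j := fun j => by
    have := N.power_pos j
    have : (0 : ℝ) < N.antennas j := by exact_mod_cast N.antennas_pos j
    positivity
  -- Any constant above all `d j` works; the summand `1` makes the inequality strict.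
  set L : ℝ := 1 + ∑ j, d j with hL
  have hL0 : 0 < L := add_pos_of_pos_of_nonneg one_pos (Finset.sum_nonneg fun j _ => (hd0 j).le)
  have hdL : ∀ j, d j < L := fun j => by
    have := Finset.single_le_sum (f := d) (fun j _ => (hd0 j).le) (Finset.mem_univ j)
    linarith
  have hα : 0 < 1 / N.alpha := one_div_pos.2 (by linarith [N.alpha_gt])
  refine ⟨d k / L, fun τ => L * τ ^ (-(1 / N.alpha)), div_pos (hd0 k) hL0, ?_, ?_⟩
  · refine tendsto_nhdsWithin_iff.2 ⟨?_, ?_⟩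
    · simpa using (tendsto_rpow_neg_atTop hα).const_mul L
    · filter_upwards [eventually_gt_atTop 0] with τ hτ
      exact mul_pos hL0 (Real.rpow_pos_of_pos hτ _)
  · filter_upwards [eventually_gt_atTop 0] with τ hτ
    have := Real.rpow_pos_of_pos hτ (-(1 / N.alpha))
    refine ⟨fun j => ?_, ?_⟩
    · rw [N.servingRadius_eq hτ.le]
      exact mul_lt_mul_of_pos_right (hdL j) this
    · rw [N.servingRadius_eq hτ.le]
      field_simp
      rfl

lemma tendsto_const_mul_disk_area (C : ℝ) :
    Tendsto (fun ρ : ℝ => C * (Real.pi * ρ ^ 2)) (𝓝[>] 0) (𝓝 0) := by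
  have : Continuous fun ρ : ℝ => C * (Real.pi * ρ ^ 2) := by fun_prop
  simpa using (this.tendsto 0).mono_left nhdsWithin_le_nhds

namespace IsModel

variable (hS : IsModel μ S) [IsProbabilityMeasure μ]
include hS

lemma eventually_measureReal_crowded_le (k : Fin K) {ε : ℝ} (hε : 0 < ε) :
    ∀ᶠ ρ in 𝓝[>] (0 : ℝ), μ.real (crowded S k ρ) ≤ ε * (Real.pi * ρ ^ 2) := by
  filter_upwards [(tendsto_const_mul_disk_area
    (N.bsDensity k * (N.bsDensity k + ∑ j, N.bsDensity j))).eventually (Iic_mem_nhds hε),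
    self_mem_nhdsWithin] with ρ h hρ
  refine (hS.measureReal_crowded_le k (le_of_lt hρ)).trans ?_
  rw [pow_two (Real.pi * ρ ^ 2), ← mul_assoc]
  exact mul_le_mul_of_nonneg_right h (by positivity)

lemma measureReal_occupied_ball_le (k : Fin K) {ρ : ℝ} (hρ : 0 ≤ ρ) :
    μ.real (occupied S k (Metric.ball 0 ρ)) ≤ N.bsDensity k * (Real.pi * ρ ^ 2) := by
  rw [← volume_real_ball hρ]
  exact (hS.bs_ppp k).measureReal_pointCount_ne_zero_le measurableSet_ball measure_ball_lt_top.ne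

/-- The threshold `η` must not depend on `ρ`, since it fixes the interference level `x` before `ρ`
tends to `0`. -/
lemma exists_measureReal_weakFading_le (k : Fin K) {ε : ℝ} (hε : 0 < ε) :
    ∃ η : ℝ, 0 < η ∧ ∀ ρ, 0 ≤ ρ →
      μ.real (weakFading S k ρ η) ≤ ε * (Real.pi * ρ ^ 2) := by
  have hl := N.bsDensity_pos k
  obtain ⟨η, hη, h⟩ := exists_rayleigh_sqNorm_lt_le (N.antennas_pos k)
    (ENNReal.ofReal_pos.2 (div_pos hε hl))
  refine ⟨η, hη, fun ρ hρ => ?_⟩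
  rw [Measure.real, ← volume_real_ball hρ]
  refine ENNReal.toReal_le_of_le_ofReal (by positivity) ?_
  refine ((hS.measure_weakFading_le k ρ η).trans (mul_le_mul_right h _)).trans_eq ?_
  rw [← ofReal_measureReal (measure_ball_lt_top (μ := volume) (x := (0 : Plane))).ne,
    ← ENNReal.ofReal_mul hl.le, ← ENNReal.ofReal_mul (by positivity)]
  congr 1
  field_simp

/-- Markov's inequality is applied on the event that the disk is occupied. Without that restriction
it would give only a bound of order `ρ²`, the same order as the association probability. -/
lemma eventually_measureReal_strongInterference_le (k : Fin K) {ε x : ℝ} (hε : 0 < ε)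
    (hx : 0 < x) :
    ∀ᶠ ρ in 𝓝[>] (0 : ℝ), μ.real (strongInterference S k ρ x) ≤ ε * (Real.pi * ρ ^ 2) := by
  have hl := N.bsDensity_pos k
  have hΛ : (∑ j, ENNReal.ofReal (N.bsDensity j) * (ENNReal.ofReal (N.interfererGain j) *
      ∫⁻ v, ENNReal.ofReal (sqNorm v) ∂rayleigh (N.antennas j))) ≠ ∞ :=
    ENNReal.sum_ne_top.2 fun j _ => ENNReal.mul_ne_top ENNReal.ofReal_ne_top
      (ENNReal.mul_ne_top ENNReal.ofReal_ne_top (lintegral_sqNorm_rayleigh_ne_top _))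
  have ht := ENNReal.Tendsto.const_mul (tendsto_lintegral_relPathLoss N.alpha_gt) (Or.inr hΛ)
  rw [mul_zero] at ht
  have hpos : 0 < ENNReal.ofReal (x * (ε / N.bsDensity k)) := ENNReal.ofReal_pos.2 (by positivity)
  filter_upwards [ht.eventually (Iic_mem_nhds hpos), self_mem_nhdsWithin] with ρ h hρ
  have hρ : 0 < ρ := hρ
  set E := occupied S k (Metric.ball 0 ρ)
  have hm := hS.measurable_farInterference ρ
  have h1 := mul_meas_ge_le_lintegral (μ := μ.restrict E) hm (ENNReal.ofReal x)
  rw [hS.lintegral_farInterference_occupied, Measure.restrict_apply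
    (measurableSet_le measurable_const hm), Set.inter_comm] at h1
  have h2 := h1.trans (mul_le_mul_right h _)
  have h3 := ENNReal.toReal_mono (by finiteness) h2
  rw [ENNReal.toReal_mul, ENNReal.toReal_mul, ENNReal.toReal_ofReal hx.le,
    ENNReal.toReal_ofReal (by positivity)] at h3
  change x * μ.real (strongInterference S k ρ x) ≤ μ.real E * _ at h3
  have h4 := hS.measureReal_occupied_ball_le k hρ.le
  refine le_of_mul_le_mul_left ?_ hx
  calc x * μ.real (strongInterference S k ρ x)
      ≤ μ.real E * (x * (ε / N.bsDensity k)) := h3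
    _ ≤ N.bsDensity k * (Real.pi * ρ ^ 2) * (x * (ε / N.bsDensity k)) := by gcongr
    _ = x * (ε * (Real.pi * ρ ^ 2)) := by field_simp

/-- A station of tier `k` in the punctured serving disk forces association unless the larger disk is
crowded. The area `κ²πρ²` of the serving disk supplies the leading term. -/
lemma le_measureReal_assocTier {τ ρ κ : ℝ} {k : Fin K} (hτ : 0 < τ)
    (hρ : ∀ j, N.servingRadius τ j < ρ) (hκ : N.servingRadius τ k = κ * ρ) :
    N.bsDensity k * κ ^ 2 * (Real.pi * ρ ^ 2) -
        (N.bsDensity k * κ ^ 2 * (Real.pi * ρ ^ 2)) ^ 2 - μ.real (crowded S k ρ) ≤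
      μ.real {ω | AssocTier S τ ω 0 k} := by
  have hr := (N.servingRadius_pos hτ k).le
  set r := N.servingRadius τ k
  set B : Set Plane := Metric.ball 0 r \ {0}
  have hB : MeasurableSet B := measurableSet_ball.diff (measurableSet_singleton 0)
  have hv : volume B = volume (Metric.ball (0 : Plane) r) :=
    measure_sdiff_null (measure_singleton 0)
  have h1 := (hS.bs_ppp k).le_measureReal_pointCount_ne_zero (N.bsDensity_pos k).le hB
    (hv.trans_ne measure_ball_lt_top.ne)
  have h2 : volume.real B = Real.pi * r ^ 2 := by
    rw [Measure.real, hv, ← Measure.real, volume_real_ball hr]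
  have h3 : N.bsDensity k * volume.real B = N.bsDensity k * κ ^ 2 * (Real.pi * ρ ^ 2) := by
    rw [h2, hκ]; ring
  rw [h3] at h1
  have h4 : occupied S k B ⊆ {ω | AssocTier S τ ω 0 k} ∪ crowded S k ρ := fun ω hω => by
    by_cases hc : ω ∈ crowded S k ρ
    · exact Or.inr hc
    · exact Or.inl (assocTier_of_notMem_crowded hρ hc hω)
  have h5 := (measureReal_mono h4).trans (measureReal_union_le (μ := μ) _ _)
  change _ ≤ μ.real (occupied S k B) at h1
  linarith

lemma tendsto_connectionProbInt {β : ℝ} (hβ : 0 < β) {k : Fin K} (hk : 0 < N.ratio k)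
    (act : ℝ → Ω → Fin K → ℕ → Prop) :
    Tendsto (fun τ : ℝ => connectionProbInt S μ τ (act τ) β k) atTop (𝓝 1) := by
  obtain ⟨κ, ρ, hκ, hρ, hρr⟩ := N.exists_radius k
  have hl := N.bsDensity_pos k
  have hP := N.power_pos k
  set a := N.bsDensity k * κ ^ 2 with ha
  have ha0 : 0 < a := by positivity
  have hW : ∀ᵐ ω ∂μ, ∀ j n, (S.weight j n ω)ᴴ * S.weight j n ω = 1 :=
    ae_all_iff.2 fun j => ae_all_iff.2 fun n => (hS.weight_orthonormal j n).mono fun _ h => h.1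
  refine tendsto_order.2 ⟨fun b hb => ?_, fun b hb => Eventually.of_forall fun τ =>
    lt_of_le_of_lt ?_ hb⟩
  swap
  · refine ENNReal.toReal_le_of_le_ofReal zero_le_one ?_
    rw [ENNReal.ofReal_one]
    exact prob_le_one
  set ε := (1 - b) / 2 with hε
  have hε0 : 0 < ε := by linarith
  -- Three bad events at `(ε a / 6) V` each total `ε · a V / 2`, which is at most `ε` times the
  -- association probability.
  have hδ : 0 < ε * a / 6 := by positivity
  obtain ⟨η, hη, hweak⟩ := hS.exists_measureReal_weakFading_le k hδ
  have hx : 0 < N.ratio k * N.power k * η / β := by positivity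
  filter_upwards [hρr, eventually_gt_atTop 0,
    hρ.eventually (hS.eventually_measureReal_crowded_le k hδ),
    -- The crowding bound `a V / 4`, together with `(a V)² ≤ a V / 4`, leaves `a V / 2` in `hAlow`.
    hρ.eventually (hS.eventually_measureReal_crowded_le k (by positivity : 0 < a / 4)),
    hρ.eventually (hS.eventually_measureReal_strongInterference_le k hδ hx),
    hρ.eventually ((tendsto_const_mul_disk_area a).eventually
      (Iic_mem_nhds (by norm_num : (0 : ℝ) < 1 / 4))),
    hρ.eventually self_mem_nhdsWithin] with τ hr hτ hc hc' hs hV hρ0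
  have hρ0 : 0 < ρ τ := hρ0
  have hV0 : 0 < Real.pi * ρ τ ^ 2 := by positivity
  set V := Real.pi * ρ τ ^ 2
  have hw := hweak (ρ τ) hρ0.le
  set A := {ω | AssocTier S τ ω 0 k} with hA
  have hAm : MeasurableSet A := hS.measurableSet_assocTier τ k
  have hAlow : a * V / 2 ≤ μ.real A := by
    have h := hS.le_measureReal_assocTier hτ hr.1 hr.2
    have hV : a * V ≤ 1 / 4 := hV
    have : (a * V) ^ 2 ≤ a * V / 4 := by nlinarith [mul_pos ha0 hV0]
    linarith
  have hApos : 0 < μ.real A := lt_of_lt_of_le (by positivity) hAlow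
  set T := {ω | ∃ b, Serves S τ ω k b 0 ∧ ENNReal.ofReal β ≤ sinr S (act τ) 0 ω k b} with hT
  have hbad : μ.real (A ∩ Tᶜ) ≤ ε * μ.real A := by
    have hsub : (A ∩ Tᶜ : Set Ω) ≤ᵐ[μ] (crowded S k (ρ τ) ∪ (weakFading S k (ρ τ) η ∪
        strongInterference S k (ρ τ) (N.ratio k * N.power k * η / β)) : Set Ω) := by
      filter_upwards [hW] with ω hω hAT
      by_contra hn
      change ¬ (_ ∨ (_ ∨ _)) at hn
      simp only [not_or] at hn
      exact hAT.2 (exists_serves_le_sinr hk hβ hη (hr.1 k) hω hAT.1 hn.1 hn.2.1 hn.2.2 (act τ))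
    have h1 : μ.real (A ∩ Tᶜ) ≤ _ := ENNReal.toReal_mono (measure_ne_top _ _)
      (measure_mono_ae hsub)
    have h2 := h1.trans (measureReal_union_le (μ := μ) _ _)
    have h3 := measureReal_union_le (μ := μ) (weakFading S k (ρ τ) η)
      (strongInterference S k (ρ τ) (N.ratio k * N.power k * η / β))
    have h4 := mul_le_mul_of_nonneg_left hAlow hε0.le
    linarith
  have hprob : IsProbabilityMeasure μ[|A] :=
    cond_isProbabilityMeasure fun h => hApos.ne' (by rw [Measure.real, h]; rfl)
  have h1 : (μ[|A]).real Tᶜ ≤ ε := by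
    rw [Measure.real, cond_apply hAm, ENNReal.toReal_mul, ENNReal.toReal_inv]
    change (μ.real A)⁻¹ * μ.real (A ∩ Tᶜ) ≤ ε
    calc (μ.real A)⁻¹ * μ.real (A ∩ Tᶜ) ≤ (μ.real A)⁻¹ * (ε * μ.real A) := by gcongr
      _ = ε := by field_simp
  -- As `act` is arbitrary, `T` need not be measurable; subadditivity replaces the complement rule.
  have h2 := measureReal_union_le (μ := μ[|A]) T Tᶜ
  rw [Set.union_compl_self, probReal_univ] at h2
  change b < (μ[|A]).real T
  linarith

end IsModel

end HetNet

theorem mainTheorem10 {K : ℕ} (N : HetNet K)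
    {Ω : Type*} [MeasurableSpace Ω] (μ : Measure Ω) [IsProbabilityMeasure μ]
    (S : N.Randomness Ω) (hS : HetNet.IsModel μ S)
    (β : ℝ) (hβ : 0 < β) (k : Fin K) (hk : 0 < N.ratio k) :
    Tendsto (fun τ : ℝ => HetNet.connectionProbInt S μ τ (HetNet.Active S τ) β k)
        atTop (𝓝 1) ∧
      ∀ A : ℝ → Fin K → ℝ, (∀ τ j, 0 ≤ A τ j ∧ A τ j ≤ 1) →
        Tendsto (fun τ : ℝ => HetNet.connectionProbInt S μ τ (HetNet.Retained S (A τ)) β k)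
          atTop (𝓝 1) :=
  ⟨hS.tendsto_connectionProbInt hβ hk _, fun _ _ => hS.tendsto_connectionProbInt hβ hk _⟩
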